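/- **Direct Product Theorem for quantum search.** There is an absolute constant $c>0$ such that the following holds for all integers $N,T,K\ge 0$. Let $A$ be a quantum algorithm that makes $T$ queries to an oracle string $X\in\{0,1\}^N$ and outputs a set $S\subseteq\{1,\dots,N\}$, the positions that it reports as $1$ bits. That is, $A$ works on basis states $|i,b,z\rangle$ with $i\in\{1,\dots,N\}$, $b\in\{0,1\}$ and $z$ in a finite set; starting from a fixed unit vector, it applies $U_T O_X U_{T-1} O_X\cdots U_1 O_X U_0$, where $O_X|i,b,z\rangle=|i,b\oplus X_i,z\rangle$ and the unitaries $U_0,\dots,U_T$ do not depend on $X$; then it measures in the standard basis, and $S$ is a function of the outcome. Suppose that - every position that $A$ reports is verified: for every $X\in\{0,1\}^N$, with probability $1$ all $i\in S$ satisfy $X_i=1$; or - $A$ makes at least $K$ queries: $T\ge K$ (in this case $A$ may report wrong positions). If $\delta$ is the minimum, over all $X\in\{0,1\}^N$ of Hamming weight $|X|=K$, of the probability that $A$ on input $X$ finds all $K$ of the $1$ bits (that is, that $S=\{i : X_i=1\}$), then $$\delta\le\left(\frac{cT^2}{N}\right)^K .$$ -/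

import Mathlib

open scoped Matrix

namespace QuantumQuery

/-- Labels of the computational basis: a query register `i`, an answer bit `b`, and a finite
workspace `z`. -/
abbrev Basis (N : ℕ) (W : Type) : Type := Fin N × Bool × W

/-- The query transformation of the oracle string `X`: it sends the basis state `|i, b, z⟩` to
`|i, b ⊕ X i, z⟩`. In terms of amplitudes, the new amplitude at `(i, b, z)` is the old one at
`(i, b ⊕ X i, z)`, because `b ↦ b ⊕ X i` is an involution. -/
def query {N : ℕ} {W : Type} (X : Fin N → Bool) (ψ : Basis N W → ℂ) : Basis N W → ℂ :=
  fun s => ψ (s.1, Bool.xor s.2.1 (X s.1), s.2.2)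

/-- The set of positions of the `1` bits of `X`. -/
def marked {N : ℕ} (X : Fin N → Bool) : Finset (Fin N) :=
  Finset.univ.filter (fun i => X i = true)

/-- The Hamming weight of `X`. -/
def weight {N : ℕ} (X : Fin N → Bool) : ℕ := (marked X).card

/-- A quantum algorithm with `T` queries to an oracle string of length `N`: a unit initial state,
the oracle-independent unitaries `U 0, …, U T` between which the queries are made, and a
final measurement in the computational basis whose outcome is read as a set of positions, namely
the positions that the algorithm reports as `1` bits. -/
structure Algorithm (N T : ℕ) (W : Type) [Fintype W] [DecidableEq W] where
  init : Basis N W → ℂ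
  init_unit : ∑ s, ‖init s‖ ^ 2 = 1
  U : Fin (T + 1) → Matrix.unitaryGroup (Basis N W) ℂ
  output : Basis N W → Finset (Fin N)

namespace Algorithm

variable {N T : ℕ} {W : Type} [Fintype W] [DecidableEq W]

/-- The state `U t · O_X · U (t - 1) ⋯ O_X · U 0 · init` after `t` queries to `X`. -/
noncomputable def state (A : Algorithm N T W) (X : Fin N → Bool) (t : Fin (T + 1)) :
    Basis N W → ℂ :=
  Fin.induction (motive := fun _ => Basis N W → ℂ)
    ((A.U 0 : Matrix (Basis N W) (Basis N W) ℂ) *ᵥ A.init)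
    (fun j ψ => (A.U j.succ : Matrix (Basis N W) (Basis N W) ℂ) *ᵥ query X ψ) t

/-- The probability that the algorithm, run on `X`, outputs exactly the set `S`. -/
noncomputable def outputProb (A : Algorithm N T W) (X : Fin N → Bool) (S : Finset (Fin N)) : ℝ :=
  ∑ s ∈ Finset.univ.filter (fun s => A.output s = S), ‖A.state X (Fin.last T) s‖ ^ 2

/-- The probability that the algorithm finds all the `1` bits of `X`. -/
noncomputable def findProb (A : Algorithm N T W) (X : Fin N → Bool) : ℝ :=
  A.outputProb X (marked X)

/-- The algorithm reports only `1` bits that are really there: on no oracle string does it, with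
positive probability, report a position that holds a `0`. -/
def Verified (A : Algorithm N T W) : Prop :=
  ∀ (X : Fin N → Bool) (S : Finset (Fin N)), 0 < A.outputProb X S → S ⊆ marked X

end Algorithm

end QuantumQuery

namespace QuantumQuery

/-! The final state on the oracle with marked set `S` splits as a sum over `R ⊆ S` of vectors
`component R` that do not depend on `S` (`state_indicator`). A query either leaves `R` unchanged or
adds one position, at amplitude cost at most 2, so level `j` has total norm at most `2 ^ j *
T.choose j` (`levelMass_component_le`). Each outcome names a single `S`, so the success
probabilities summed over all `S` of size `K` are controlled by the levels up to `K`
(`sum_findProb_le`). Averaging over the `N.choose K` sets gives the bound when `K ≤ T`. If `T < K`,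
verification kills every component that could contribute to success (`Verified.findProb_eq_zero`).
-/

/-- The oracle string whose set of `1` positions is `S`. -/
def indicator {N : ℕ} (S : Finset (Fin N)) : Fin N → Bool := fun i => decide (i ∈ S)

@[simp] theorem marked_indicator {N : ℕ} (S : Finset (Fin N)) : marked (indicator S) = S := by
  ext i; simp [marked, indicator]

@[simp] theorem indicator_marked {N : ℕ} (X : Fin N → Bool) : indicator (marked X) = X := by
  ext i; simp [marked, indicator]

/-- Flipping the answer bit of a basis label. -/
def flip {N : ℕ} {W : Type} (s : Basis N W) : Basis N W := (s.1, !s.2.1, s.2.2)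

theorem flip_flip {N : ℕ} {W : Type} (s : Basis N W) : flip (flip s) = s := by
  simp [flip]

theorem query_indicator {N : ℕ} {W : Type} (S : Finset (Fin N)) (ψ : Basis N W → ℂ)
    (s : Basis N W) : query (indicator S) ψ s = if s.1 ∈ S then ψ (flip s) else ψ s := by
  by_cases h : s.1 ∈ S <;> simp [query, indicator, flip, h]

/-- The part of the query transformation of `R` that is caused by the last element of `R` to be
discovered: `Ψ` is a family of vectors indexed by the sets discovered so far. -/
def discover {N : ℕ} {W : Type} (Ψ : Finset (Fin N) → Basis N W → ℂ) (R : Finset (Fin N)) :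
    Basis N W → ℂ :=
  fun s => if s.1 ∈ R then Ψ (R.erase s.1) (flip s) - Ψ (R.erase s.1) s else 0

/-- For a queried position `i ∈ S`, the oracle of `S` flips the answer bit on `Ψ R` with `i ∉ R`
while that of `R` does not. The difference is charged to `insert i R`. -/
theorem query_sum_powerset {N : ℕ} {W : Type} (Ψ : Finset (Fin N) → Basis N W → ℂ)
    (S : Finset (Fin N)) :
    query (indicator S) (∑ R ∈ S.powerset, Ψ R) =
      ∑ R ∈ S.powerset, (query (indicator R) (Ψ R) + discover Ψ R) := by
  funext s
  rw [query_indicator]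
  simp only [Finset.sum_apply, Pi.add_apply, query_indicator, discover]
  by_cases h : s.1 ∈ S
  · rw [if_pos h]
    obtain ⟨Q, hQ, rfl⟩ : ∃ Q, s.1 ∉ Q ∧ S = insert s.1 Q :=
      ⟨S.erase s.1, Finset.notMem_erase _ _, (Finset.insert_erase h).symm⟩
    rw [Finset.sum_powerset_insert hQ, Finset.sum_powerset_insert hQ, ← Finset.sum_add_distrib,
      ← Finset.sum_add_distrib]
    refine Finset.sum_congr rfl fun R hR => ?_
    have hR' : s.1 ∉ R := fun h' => hQ (Finset.mem_powerset.1 hR h')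
    simp [hR', Finset.erase_insert hR']
    ring
  · rw [if_neg h]
    refine Finset.sum_congr rfl fun R hR => ?_
    have hR' : s.1 ∉ R := fun h' => h (Finset.mem_powerset.1 hR h')
    simp [hR']

theorem sum_norm_sq_unitary {ι : Type*} [Fintype ι] [DecidableEq ι]
    (U : Matrix.unitaryGroup ι ℂ) (v : ι → ℂ) :
    ∑ s, ‖((U : Matrix ι ι ℂ) *ᵥ v) s‖ ^ 2 = ∑ s, ‖v s‖ ^ 2 := by
  have key : ∀ w : ι → ℂ, ((∑ s, ‖w s‖ ^ 2 : ℝ) : ℂ) = star w ⬝ᵥ w := by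
    intro w
    simp [dotProduct, ← Complex.conj_mul']
  have h : star ((U : Matrix ι ι ℂ) *ᵥ v) ⬝ᵥ ((U : Matrix ι ι ℂ) *ᵥ v) = star v ⬝ᵥ v := by
    have hU : (U : Matrix ι ι ℂ)ᴴ * (U : Matrix ι ι ℂ) = 1 :=
      Matrix.mem_unitaryGroup_iff'.1 U.2
    rw [Matrix.star_mulVec, ← Matrix.dotProduct_mulVec, Matrix.mulVec_mulVec, hU,
      Matrix.one_mulVec]
  rw [← key, ← key] at h
  exact_mod_cast h

theorem sum_comp_flip {N : ℕ} {W : Type} [Fintype W] (f : Basis N W → ℝ) :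
    ∑ s, f (flip s) = ∑ s, f s :=
  Equiv.sum_comp ⟨flip, flip, flip_flip, flip_flip⟩ f

theorem sum_norm_sq_query {N : ℕ} {W : Type} [Fintype W] (X : Fin N → Bool)
    (ψ : Basis N W → ℂ) : ∑ s, ‖query X ψ s‖ ^ 2 = ∑ s, ‖ψ s‖ ^ 2 := by
  let g : Basis N W → Basis N W := fun s => (s.1, Bool.xor s.2.1 (X s.1), s.2.2)
  have hg : ∀ s, g (g s) = s := fun s => by simp [g]
  exact Equiv.sum_comp ⟨g, g, hg, hg⟩ (fun s => ‖ψ s‖ ^ 2)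

theorem sum_norm_add_sq_le {ι : Type*} (F : Finset ι) (f g : ι → ℂ) {a b : ℝ} (ha : 0 ≤ a)
    (hb : 0 ≤ b) (hf : ∑ x ∈ F, ‖f x‖ ^ 2 ≤ a ^ 2) (hg : ∑ x ∈ F, ‖g x‖ ^ 2 ≤ b ^ 2) :
    ∑ x ∈ F, ‖f x + g x‖ ^ 2 ≤ (a + b) ^ 2 := by
  have h1 : ∑ x ∈ F, ‖f x‖ * ‖g x‖ ≤ a * b := by
    refine abs_le_of_sq_le_sq' ?_ (mul_nonneg ha hb) |>.2
    calc (∑ x ∈ F, ‖f x‖ * ‖g x‖) ^ 2 ≤ (∑ x ∈ F, ‖f x‖ ^ 2) * ∑ x ∈ F, ‖g x‖ ^ 2 :=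
          Finset.sum_mul_sq_le_sq_mul_sq _ _ _
      _ ≤ a ^ 2 * b ^ 2 := by gcongr
      _ = (a * b) ^ 2 := by ring
  calc ∑ x ∈ F, ‖f x + g x‖ ^ 2
      ≤ ∑ x ∈ F, (‖f x‖ ^ 2 + 2 * (‖f x‖ * ‖g x‖) + ‖g x‖ ^ 2) := by
        refine Finset.sum_le_sum fun x _ => ?_
        calc ‖f x + g x‖ ^ 2 ≤ (‖f x‖ + ‖g x‖) ^ 2 := by gcongr; exact norm_add_le _ _
          _ = _ := by ring
    _ = ∑ x ∈ F, ‖f x‖ ^ 2 + 2 * ∑ x ∈ F, ‖f x‖ * ‖g x‖ + ∑ x ∈ F, ‖g x‖ ^ 2 := by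
        rw [Finset.sum_add_distrib, Finset.sum_add_distrib, Finset.mul_sum]
    _ ≤ (a + b) ^ 2 := by nlinarith

/-! ### Mass of the levels, and its growth under discovery -/

/-- The total squared norm of the members `Ψ R` with `R.card = j`. -/
noncomputable def levelMass {N : ℕ} {W : Type} [Fintype W]
    (Ψ : Finset (Fin N) → Basis N W → ℂ) (j : ℕ) : ℝ :=
  ∑ R ∈ Finset.powersetCard j Finset.univ, ∑ s, ‖Ψ R s‖ ^ 2

theorem levelMass_nonneg {N : ℕ} {W : Type} [Fintype W]
    (Ψ : Finset (Fin N) → Basis N W → ℂ) (j : ℕ) : 0 ≤ levelMass Ψ j :=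
  Finset.sum_nonneg fun _ _ => Finset.sum_nonneg fun _ _ => by positivity

theorem levelMass_eq_sum_product {N : ℕ} {W : Type} [Fintype W]
    (Ψ : Finset (Fin N) → Basis N W → ℂ) (j : ℕ) : levelMass Ψ j =
      ∑ x ∈ Finset.powersetCard j Finset.univ ×ˢ (Finset.univ : Finset (Basis N W)),
        ‖Ψ x.1 x.2‖ ^ 2 := by
  rw [Finset.sum_product]
  rfl

theorem levelMass_add_le {N : ℕ} {W : Type} [Fintype W]
    (Ψ Φ : Finset (Fin N) → Basis N W → ℂ) (j : ℕ) {a b : ℝ} (ha : 0 ≤ a) (hb : 0 ≤ b)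
    (hΨ : levelMass Ψ j ≤ a ^ 2) (hΦ : levelMass Φ j ≤ b ^ 2) :
    levelMass (Ψ + Φ) j ≤ (a + b) ^ 2 := by
  rw [levelMass_eq_sum_product] at hΨ hΦ ⊢
  simp only [Pi.add_apply]
  exact sum_norm_add_sq_le _ (fun x : Finset (Fin N) × Basis N W => Ψ x.1 x.2)
    (fun x => Φ x.1 x.2) ha hb hΨ hΦ

theorem levelMass_discover_zero {N : ℕ} {W : Type} [Fintype W]
    (Ψ : Finset (Fin N) → Basis N W → ℂ) : levelMass (discover Ψ) 0 = 0 := by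
  simp [levelMass, discover]

/-- Erasing `i` is injective on the sets that contain `i`. Since a basis state queries only one
position, discovery costs no factor of `N` or `j`. -/
theorem sum_erase_le {N : ℕ} (f : Finset (Fin N) → ℝ) (hf : ∀ R, 0 ≤ f R) (j : ℕ) (i : Fin N) :
    ∑ R ∈ Finset.powersetCard (j + 1) Finset.univ, (if i ∈ R then f (R.erase i) else 0) ≤
      ∑ R ∈ Finset.powersetCard j Finset.univ, f R := by
  rw [← Finset.sum_filter]
  rw [← Finset.sum_image (f := f) (g := fun R : Finset (Fin N) => R.erase i)
    (s := (Finset.powersetCard (j + 1) Finset.univ).filter fun R => i ∈ R)]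
  · refine Finset.sum_le_sum_of_subset_of_nonneg ?_ fun R _ _ => hf R
    intro Q hQ
    simp only [Finset.mem_image, Finset.mem_filter, Finset.mem_powersetCard_univ] at hQ ⊢
    obtain ⟨R, ⟨hR, hi⟩, rfl⟩ := hQ
    rw [Finset.card_erase_of_mem hi, hR, Nat.add_sub_cancel]
  · intro R hR Q hQ h
    simp only [Finset.coe_filter, Set.mem_ofPred_eq] at hR hQ
    rw [← Finset.insert_erase hR.2, ← Finset.insert_erase hQ.2]
    exact congrArg (insert i) h

/-- The 4 comes from `‖a - b‖² ≤ 2 (‖a‖² + ‖b‖²)` and the invariance of the norm under `flip`. -/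
theorem levelMass_discover_succ_le {N : ℕ} {W : Type} [Fintype W]
    (Ψ : Finset (Fin N) → Basis N W → ℂ) (j : ℕ) :
    levelMass (discover Ψ) (j + 1) ≤ 4 * levelMass Ψ j := by
  unfold levelMass
  rw [Finset.sum_comm]
  have h : ∀ s : Basis N W, ∑ R ∈ Finset.powersetCard (j + 1) Finset.univ, ‖discover Ψ R s‖ ^ 2 ≤
      ∑ R ∈ Finset.powersetCard j Finset.univ, 2 * (‖Ψ R (flip s)‖ ^ 2 + ‖Ψ R s‖ ^ 2) := by
    intro s
    refine le_trans (Finset.sum_le_sum fun R _ => ?_) (sum_erase_le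
      (fun R => 2 * (‖Ψ R (flip s)‖ ^ 2 + ‖Ψ R s‖ ^ 2)) (fun R => by positivity) j s.1)
    unfold discover
    split_ifs with hs
    · have h1 := norm_sub_le (Ψ (R.erase s.1) (flip s)) (Ψ (R.erase s.1) s)
      have h2 := norm_nonneg (Ψ (R.erase s.1) (flip s) - Ψ (R.erase s.1) s)
      nlinarith [sq_nonneg (‖Ψ (R.erase s.1) (flip s)‖ - ‖Ψ (R.erase s.1) s‖)]
    · simp
  refine (Finset.sum_le_sum fun s _ => h s).trans_eq ?_
  rw [Finset.sum_comm, Finset.mul_sum]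
  refine Finset.sum_congr rfl fun R _ => ?_
  rw [← Finset.mul_sum, Finset.sum_add_distrib, sum_comp_flip (fun s => ‖Ψ R s‖ ^ 2)]
  ring

namespace Algorithm

variable {N T : ℕ} {W : Type} [Fintype W] [DecidableEq W]

/-! ### Decomposition of the state by discovered positions -/

/-- The component of the state after `t` queries in which exactly the `1` bits in `R` have been
discovered. -/
noncomputable def component (A : Algorithm N T W) (t : Fin (T + 1)) :
    Finset (Fin N) → Basis N W → ℂ :=
  Fin.induction (motive := fun _ => Finset (Fin N) → Basis N W → ℂ)
    (fun R => if R = ∅ then (A.U 0 : Matrix (Basis N W) (Basis N W) ℂ) *ᵥ A.init else 0)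
    (fun j Ψ R => (A.U j.succ : Matrix (Basis N W) (Basis N W) ℂ) *ᵥ
      (query (indicator R) (Ψ R) + discover Ψ R)) t

theorem component_zero (A : Algorithm N T W) (R : Finset (Fin N)) :
    A.component 0 R =
      if R = ∅ then (A.U 0 : Matrix (Basis N W) (Basis N W) ℂ) *ᵥ A.init else 0 := rfl

theorem component_succ (A : Algorithm N T W) (j : Fin T) (R : Finset (Fin N)) :
    A.component j.succ R = (A.U j.succ : Matrix (Basis N W) (Basis N W) ℂ) *ᵥ
      (query (indicator R) (A.component j.castSucc R) + discover (A.component j.castSucc) R) := by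
  simp only [component, Fin.induction_succ]

theorem state_zero (A : Algorithm N T W) (X : Fin N → Bool) :
    A.state X 0 = (A.U 0 : Matrix (Basis N W) (Basis N W) ℂ) *ᵥ A.init := rfl

theorem state_succ (A : Algorithm N T W) (X : Fin N → Bool) (j : Fin T) :
    A.state X j.succ = (A.U j.succ : Matrix (Basis N W) (Basis N W) ℂ) *ᵥ
      query X (A.state X j.castSucc) := by
  simp only [state, Fin.induction_succ]

theorem state_indicator (A : Algorithm N T W) (S : Finset (Fin N)) (t : Fin (T + 1)) :
    A.state (indicator S) t = ∑ R ∈ S.powerset, A.component t R := by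
  induction t using Fin.induction with
  | zero => simp [state_zero, component_zero]
  | succ j ih =>
    rw [state_succ, ih, query_sum_powerset, Matrix.mulVec_sum]
    simp only [component_succ]

theorem component_eq_zero (A : Algorithm N T W) (t : Fin (T + 1)) :
    ∀ R : Finset (Fin N), (t : ℕ) < R.card → A.component t R = 0 := by
  induction t using Fin.induction with
  | zero =>
    intro R hR
    rw [component_zero, if_neg]
    rintro rfl
    simp at hR
  | succ j ih =>
    intro R hR
    rw [Fin.val_succ] at hR
    have h1 : A.component j.castSucc R = 0 := ih R (by simp; omega)
    have h2 : discover (A.component j.castSucc) R = 0 := by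
      funext s
      unfold discover
      split_ifs with hs
      · rw [ih (R.erase s.1) (by rw [Finset.card_erase_of_mem hs]; simp; omega)]
        simp
      · rfl
    have h3 : query (indicator R) (0 : Basis N W → ℂ) = 0 := rfl
    rw [component_succ, h1, h2, h3, add_zero, Matrix.mulVec_zero]

theorem levelMass_component_le (A : Algorithm N T W) (t : Fin (T + 1)) :
    ∀ j : ℕ, levelMass (A.component t) j ≤ (2 ^ j * ((t : ℕ).choose j : ℝ)) ^ 2 := by
  induction t using Fin.induction with
  | zero =>
    rintro (_ | j)
    · simp [levelMass, component_zero, sum_norm_sq_unitary, A.init_unit]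
    · have : levelMass (A.component 0) (j + 1) = 0 := by
        refine Finset.sum_eq_zero fun R hR => ?_
        rw [component_eq_zero]
        · simp
        · rw [(Finset.mem_powersetCard_univ.1 hR)]
          simp
      simp [this]
  | succ i ih =>
    have step : ∀ j, levelMass (A.component i.succ) j =
        levelMass ((fun R => query (indicator R) (A.component i.castSucc R)) +
          discover (A.component i.castSucc)) j := by
      intro j
      refine Finset.sum_congr rfl fun R _ => ?_
      rw [component_succ, sum_norm_sq_unitary]
      rfl
    have hq : ∀ j, levelMass (fun R => query (indicator R) (A.component i.castSucc R)) j =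
        levelMass (A.component i.castSucc) j := fun j =>
      Finset.sum_congr rfl fun R _ => sum_norm_sq_query _ _
    rintro (_ | j)
    · rw [step]
      refine (levelMass_add_le _ _ 0 zero_le_one le_rfl ?_ ?_).trans_eq (b := (1 + 0) ^ 2) ?_
      · rw [hq]
        simpa using ih 0
      · simp [levelMass_discover_zero]
      · simp
    -- Pascal's rule: level `j + 1` receives its own old norm plus twice that of level `j`.
    · rw [step]
      refine (levelMass_add_le _ _ (j + 1)
        (a := 2 ^ (j + 1) * ((i : ℕ).choose (j + 1) : ℝ))
        (b := 2 * (2 ^ j * ((i : ℕ).choose j : ℝ))) (by positivity) (by positivity) ?_ ?_).trans_eq ?_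
      · rw [hq]
        exact ih (j + 1)
      · refine (levelMass_discover_succ_le _ j).trans ?_
        have := ih j
        simp only [Fin.val_castSucc] at this
        linarith [mul_pow 2 (2 ^ j * ((i : ℕ).choose j : ℝ)) 2]
      · rw [Fin.val_succ, Nat.choose_succ_succ']
        push_cast
        ring

theorem findProb_indicator (A : Algorithm N T W) (S : Finset (Fin N)) :
    A.findProb (indicator S) = ∑ s, if A.output s = S then
      ‖∑ R ∈ S.powerset, A.component (Fin.last T) R s‖ ^ 2 else 0 := by
  rw [findProb, outputProb, marked_indicator, state_indicator, Finset.sum_filter]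
  simp only [Finset.sum_apply]

/-- At a fixed outcome only the set it names contributes. Cauchy–Schwarz over the subsets of that
set gives `2 ^ K`. -/
theorem sum_findProb_le (A : Algorithm N T W) (K : ℕ) :
    ∑ S ∈ Finset.powersetCard K Finset.univ, A.findProb (indicator S) ≤
      2 ^ K * ∑ j ∈ Finset.range (K + 1), levelMass (A.component (Fin.last T)) j := by
  simp only [findProb_indicator]
  rw [Finset.sum_comm]
  have hr : ∑ j ∈ Finset.range (K + 1), levelMass (A.component (Fin.last T)) j =
      ∑ s, ∑ j ∈ Finset.range (K + 1), ∑ R ∈ Finset.powersetCard j Finset.univ,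
        ‖A.component (Fin.last T) R s‖ ^ 2 := by
    rw [Finset.sum_comm]
    exact Finset.sum_congr rfl fun j _ => Finset.sum_comm
  rw [hr, Finset.mul_sum]
  refine Finset.sum_le_sum fun s _ => ?_
  rw [Finset.sum_ite_eq]
  split_ifs with hs
  · have hK : (A.output s).card = K := Finset.mem_powersetCard_univ.1 hs
    calc ‖∑ R ∈ (A.output s).powerset, A.component (Fin.last T) R s‖ ^ 2
        ≤ (∑ R ∈ (A.output s).powerset, ‖A.component (Fin.last T) R s‖) ^ 2 := by
          gcongr; exact norm_sum_le _ _
      _ ≤ ((A.output s).powerset.card : ℝ) *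
          ∑ R ∈ (A.output s).powerset, ‖A.component (Fin.last T) R s‖ ^ 2 :=
          sq_sum_le_card_mul_sum_sq
      _ = 2 ^ K * ∑ j ∈ Finset.range (K + 1), ∑ R ∈ Finset.powersetCard j (A.output s),
          ‖A.component (Fin.last T) R s‖ ^ 2 := by
          rw [Finset.card_powerset, Finset.sum_powerset, hK]
          push_cast
          rfl
      _ ≤ _ := by
          refine mul_le_mul_of_nonneg_left (Finset.sum_le_sum fun j _ => ?_) (by positivity)
          exact Finset.sum_le_sum_of_subset_of_nonneg
            (Finset.powersetCard_mono (Finset.subset_univ _)) fun _ _ _ => by positivity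
  · positivity

theorem findProb_nonneg (A : Algorithm N T W) (X : Fin N → Bool) : 0 ≤ A.findProb X :=
  Finset.sum_nonneg fun _ _ => by positivity

theorem sum_norm_sq_state (A : Algorithm N T W) (X : Fin N → Bool) (t : Fin (T + 1)) :
    ∑ s, ‖A.state X t s‖ ^ 2 = 1 := by
  induction t using Fin.induction with
  | zero => rw [state_zero, sum_norm_sq_unitary, A.init_unit]
  | succ j ih => rw [state_succ, sum_norm_sq_unitary, sum_norm_sq_query, ih]

theorem findProb_le_one (A : Algorithm N T W) (X : Fin N → Bool) : A.findProb X ≤ 1 := by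
  rw [← A.sum_norm_sq_state X (Fin.last T)]
  exact Finset.sum_le_sum_of_subset_of_nonneg (Finset.subset_univ _) fun _ _ _ => by positivity

theorem Verified.state_eq_zero {A : Algorithm N T W} (hA : A.Verified) {s : Basis N W}
    {R : Finset (Fin N)} (h : ¬ A.output s ⊆ R) : A.state (indicator R) (Fin.last T) s = 0 := by
  by_contra hs
  have hpos : 0 < A.outputProb (indicator R) (A.output s) := by
    refine Finset.sum_pos' (fun _ _ => sq_nonneg _) ⟨s, by simp, pow_pos (norm_pos_iff.2 hs) 2⟩
  exact h (by simpa using hA _ _ hpos)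

/-- The state on `R` vanishes at an outcome reporting a position outside `R`. Induction on `R`
passes this from sums over subsets to single components. -/
theorem Verified.component_eq_zero {A : Algorithm N T W} (hA : A.Verified) {s : Basis N W} :
    ∀ R : Finset (Fin N), R ⊂ A.output s → A.component (Fin.last T) R s = 0 := by
  intro R
  induction R using Finset.strongInduction with
  | H R ih =>
    intro hR
    have h := hA.state_eq_zero (s := s) (R := R) hR.2
    rw [state_indicator, Finset.sum_apply, Finset.sum_eq_single R] at h
    · exact h
    · intro Q hQ hne
      have hQR : Q ⊂ R := (Finset.mem_powerset.1 hQ).ssubset_of_ne hne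
      exact ih Q hQR (hQR.trans hR)
    · simp

theorem Verified.findProb_eq_zero {A : Algorithm N T W} (hA : A.Verified) {X : Fin N → Bool}
    (hX : T < weight X) : A.findProb X = 0 := by
  rw [← indicator_marked X, findProb_indicator]
  refine Finset.sum_eq_zero fun s _ => ?_
  split_ifs with hs
  · rw [Finset.sum_eq_zero, norm_zero, zero_pow two_ne_zero]
    intro R hR
    rcases eq_or_ne R (marked X) with rfl | hne
    · rw [A.component_eq_zero (Fin.last T) _ (by simpa [weight] using hX)]
      rfl
    · exact hA.component_eq_zero R (hs ▸ (Finset.mem_powerset.1 hR).ssubset_of_ne hne)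
  · rfl

end Algorithm

/-! ### Binomial estimates and averaging -/

/-- Levels `j < K` are affordable because `K! / j! ≤ K ^ (K - j) ≤ T ^ (K - j)`; this needs `K ≤ T`.
-/
theorem choose_sq_mul_factorial_le {T K j : ℕ} (hj : j ≤ K) (hK : K ≤ T) :
    T.choose j ^ 2 * K.factorial ≤ T ^ (2 * K) := by
  have h1 : T.choose j * j.factorial ≤ T ^ j := by
    rw [mul_comm, ← Nat.descFactorial_eq_factorial_mul_choose]
    exact Nat.descFactorial_le_pow _ _
  have h2 : T.choose j ≤ T ^ j := Nat.choose_le_pow T j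
  have h3 : K.factorial ≤ j.factorial * T ^ (K - j) :=
    by
    refine le_trans ?_ (Nat.mul_le_mul_left _ (Nat.pow_le_pow_left hK _))
    rw [← Nat.factorial_mul_descFactorial (Nat.sub_le K j), Nat.sub_sub_self hj]
    gcongr
    exact Nat.descFactorial_le_pow _ _
  calc T.choose j ^ 2 * K.factorial
      ≤ T.choose j ^ 2 * (j.factorial * T ^ (K - j)) := by gcongr
    _ = T.choose j * (T.choose j * j.factorial) * T ^ (K - j) := by ring
    _ ≤ T ^ j * T ^ j * T ^ (K - j) := by gcongr
    _ = T ^ (j + K) := by rw [← pow_add, ← pow_add]; congr 1; omega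
    _ ≤ T ^ (2 * K) := by
        rcases Nat.eq_zero_or_pos T with rfl | hT
        · simp [show K = 0 by omega, show j = 0 by omega]
        · exact Nat.pow_le_pow_right hT (by omega)

theorem half_pow_le_choose_mul_factorial {N K : ℕ} (h : 2 * K ≤ N) :
    ((N : ℝ) / 2) ^ K ≤ N.choose K * K.factorial := by
  have h1 : (N + 1 - K) ^ K ≤ N.choose K * K.factorial := by
    rw [mul_comm, ← Nat.descFactorial_eq_factorial_mul_choose]
    exact Nat.pow_sub_le_descFactorial _ _
  have h2 : ((N : ℝ) / 2) ≤ ((N + 1 - K : ℕ) : ℝ) := by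
    rw [div_le_iff₀ two_pos]
    exact_mod_cast (by omega : N ≤ (N + 1 - K) * 2)
  calc ((N : ℝ) / 2) ^ K ≤ ((N + 1 - K : ℕ) : ℝ) ^ K := by gcongr
    _ ≤ _ := by exact_mod_cast h1

namespace Algorithm

variable {N T : ℕ} {W : Type} [Fintype W] [DecidableEq W]

theorem sum_findProb_mul_factorial_le (A : Algorithm N T W) {K : ℕ} (hK : K ≤ T) :
    (∑ S ∈ Finset.powersetCard K Finset.univ, A.findProb (indicator S)) * K.factorial ≤
      (16 * (T : ℝ) ^ 2) ^ K := by
  have hm : ∀ j ∈ Finset.range (K + 1),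
      levelMass (A.component (Fin.last T)) j * K.factorial ≤ 4 ^ K * (T : ℝ) ^ (2 * K) := by
    intro j hj
    have hj' : j ≤ K := Nat.lt_succ_iff.1 (Finset.mem_range.1 hj)
    have hc : (T.choose j : ℝ) ^ 2 * K.factorial ≤ (T : ℝ) ^ (2 * K) := by
      exact_mod_cast choose_sq_mul_factorial_le hj' hK
    calc levelMass (A.component (Fin.last T)) j * K.factorial
        ≤ (2 ^ j * (T.choose j : ℝ)) ^ 2 * K.factorial := by
          gcongr
          exact A.levelMass_component_le (Fin.last T) j
      _ = 4 ^ j * ((T.choose j : ℝ) ^ 2 * K.factorial) := by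
          rw [mul_pow, ← pow_mul, mul_comm j 2, pow_mul]
          norm_num
          ring
      _ ≤ 4 ^ K * (T : ℝ) ^ (2 * K) := by
          gcongr
          norm_num
  have hsum := Finset.sum_le_sum hm
  rw [← Finset.sum_mul, Finset.sum_const, Finset.card_range, nsmul_eq_mul] at hsum
  -- The number of levels is absorbed into `2 ^ K`, so the base 16 is 2 · 2 · 4.
  have hk2 : ((K + 1 : ℕ) : ℝ) ≤ 2 ^ K := by exact_mod_cast K.lt_two_pow_self
  calc _ ≤ (2 ^ K * ∑ j ∈ Finset.range (K + 1), levelMass (A.component (Fin.last T)) j) *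
          K.factorial := by gcongr; exact A.sum_findProb_le K
    _ = 2 ^ K * ((∑ j ∈ Finset.range (K + 1), levelMass (A.component (Fin.last T)) j) *
          K.factorial) := by ring
    _ ≤ 2 ^ K * (2 ^ K * (4 ^ K * (T : ℝ) ^ (2 * K))) := by
        refine mul_le_mul_of_nonneg_left (hsum.trans ?_) (by positivity)
        gcongr
    _ = (16 * (T : ℝ) ^ 2) ^ K := by
        rw [pow_mul, ← mul_pow, ← mul_pow, ← mul_pow]
        congr 1
        ring

theorem le_of_le_findProb (A : Algorithm N T W) {K : ℕ} (hK : K ≤ T) (hKN : K ≤ N) {δ : ℝ}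
    (h0 : 0 ≤ δ) (h1 : δ ≤ 1) (hδ : ∀ X : Fin N → Bool, weight X = K → δ ≤ A.findProb X) :
    δ ≤ (32 * (T : ℝ) ^ 2 / N) ^ K := by
  rcases Nat.eq_zero_or_pos K with rfl | hK1
  · simpa using h1
  have hN : (0 : ℝ) < N := by exact_mod_cast hK1.trans_le hKN
  -- If `N < 2 * K ≤ 2 * T`, the claimed bound is at least 1. Otherwise `N.choose K * K!` is at
  -- least `(N / 2) ^ K`, which turns 16 into 32.
  rcases lt_or_ge N (2 * K) with h | h
  · refine h1.trans (one_le_pow₀ ?_)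
    rw [one_le_div hN]
    have hN' : (N : ℝ) ≤ 2 * T := by exact_mod_cast (by omega : N ≤ 2 * T)
    have hT : (1 : ℝ) ≤ T := by exact_mod_cast Nat.le_trans hK1 hK
    nlinarith
  · have hsum : (N.choose K : ℝ) * δ ≤
        ∑ S ∈ Finset.powersetCard K Finset.univ, A.findProb (indicator S) := by
      have := Finset.card_nsmul_le_sum (Finset.powersetCard K (Finset.univ : Finset (Fin N)))
        (fun S => A.findProb (indicator S)) δ fun S hS =>
          hδ _ (by rw [weight, marked_indicator]; exact Finset.mem_powersetCard_univ.1 hS)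
      simpa [Finset.card_powersetCard] using this
    have key : ((N : ℝ) / 2) ^ K * δ ≤ (16 * (T : ℝ) ^ 2) ^ K :=
      calc ((N : ℝ) / 2) ^ K * δ ≤ (N.choose K * K.factorial) * δ := by
            gcongr; exact half_pow_le_choose_mul_factorial h
        _ = (N.choose K * δ) * K.factorial := by ring
        _ ≤ _ := by gcongr
        _ ≤ _ := A.sum_findProb_mul_factorial_le hK
    have hsplit : (32 * (T : ℝ) ^ 2 / N) ^ K = (16 * (T : ℝ) ^ 2) ^ K / ((N : ℝ) / 2) ^ K := by
      rw [← div_pow]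
      congr 1
      field_simp
      ring
    rw [hsplit, le_div_iff₀ (by positivity), mul_comm]
    exact key

end Algorithm

end QuantumQuery

theorem mainTheorem4 :
    ∃ c : ℝ, 0 < c ∧
      ∀ (N T K : ℕ) (W : Type) [Fintype W] [DecidableEq W]
        (A : QuantumQuery.Algorithm N T W) (δ : ℝ),
        (A.Verified ∨ K ≤ T) →
        IsLeast {p : ℝ | ∃ X : Fin N → Bool, QuantumQuery.weight X = K ∧ A.findProb X = p} δ →
        δ ≤ (c * (T : ℝ) ^ 2 / (N : ℝ)) ^ K := by
  refine ⟨32, by norm_num, ?_⟩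
  intro N T K W _ _ A δ hA hδ
  obtain ⟨⟨X, hX, rfl⟩, hmin⟩ := hδ
  rcases le_or_gt K T with hK | hK
  · refine A.le_of_le_findProb hK ?_ (A.findProb_nonneg X) (A.findProb_le_one X)
      fun Y hY => hmin ⟨Y, hY, rfl⟩
    rw [← hX]
    simpa [QuantumQuery.weight] using (QuantumQuery.marked X).card_le_univ
  · rcases hA with hA | hA
    · rw [hA.findProb_eq_zero (hX ▸ hK)]
      positivity
    · exact absurd hA (not_le.2 hK)
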